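/- Let $r\ge 1$, $\mathbf m=(m_1,\dots,m_r)$ with integers $m_j\ge 1$, $m=m_1+\dots+m_r$, $a,b\in\mathbb C$, and $\mathbf f=(f_1,\dots,f_r)\in\mathbb C^r$ with no $f_j$ in $\{0,-1,-2,\dots\}$. Write $(c)_n=c(c+1)\cdots(c+n-1)$, $(\mathbf f)_{\mathbf m}=(f_1)_{m_1}\cdots(f_r)_{m_r}$ and $\mathbf f+\mathbf m=(f_1+m_1,\dots,f_r+m_r)$. Define $\sigma_i$ by $(f_1+x)_{m_1}\cdots(f_r+x)_{m_r}=\sum_{i=0}^m\sigma_i x^i$, and put $$C_{k,r}=\frac{1}{(\mathbf f)_{\mathbf m}}\sum_{i=k}^m\sigma_i\,\mathbf S_i^{(k)},\qquad R_{m-1}(t)=\sum_{k=0}^m(-1)^k(b)_k\,C_{k,r}\,(1-t-k)_{m-1},$$ where $\mathbf S_i^{(k)}$ are the Stirling numbers of the second kind. Suppose that $b+m\notin\{0,-1,-2,\dots\}$ and that $f_1\ne b$ if $m=r=1$. Let $\boldsymbol\lambda$ be the list of the roots of $R_{m-1}$, with multiplicity (the empty list if $R_{m-1}$ is constant, including the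 case $R_{m-1}\equiv0$), and let $p$ be its length; one has $p\le m-1$, and in the generic case $\deg R_{m-1}=m-1$ one has $p=m-1$. Suppose that no member of $\boldsymbol\lambda$ lies in $\{0,-1,-2,\dots\}$. Then $$(1-x)^a\,{}_{r+2}F_{r+1}\!\left(\begin{matrix}a,b,\mathbf f+\mathbf m\\ b+m,\mathbf f\end{matrix}\,\Big|\,x\right)=\frac{(b)_m}{(\mathbf f)_{\mathbf m}}+\Bigl(1-\frac{(b)_m}{(\mathbf f)_{\mathbf m}}\Bigr)\,{}_{p+2}F_{p+1}\!\left(\begin{matrix}1,a,\boldsymbol\lambda+1\\ b+m,\boldsymbol\lambda\end{matrix}\,\Big|\,\frac{x}{x-1}\right)$$ for all $x\in\mathbb C\setminus[1,\infty)$, and $$e^{-x}\,{}_{r+1}F_{r+1}\!\left(\begin{matrix}b,\mathbf f+\mathbf m\\ b+m,\mathbf f\end{matrix}\,\Big|\,x\right)=\frac{(b)_m}{(\mathbf f)_{\mathbf m}}+\Bigl(1-\frac{(b)_m}{(\mathbf f)_{\mathbf m}}\Bigr)\,{}_{p+1}F_{p+1}\!\left(\begin{matrix}1,\boldsymbol\lambda+1\\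 b+m,\boldsymbol\lambda\end{matrix}\,\Big|\,-x\right)$$ for all $x\in\mathbb C$. Here $(1-x)^a$ is the principal branch. In the first identity the generalized hypergeometric functions are understood as the (existing, unique) analytic continuations of their series from the unit disc to $\mathbb C\setminus[1,\infty)$; in the second they are the sums of their everywhere convergent series. -/

import Mathlib

open scoped Nat

noncomputable section

namespace HypergeomCorollary

/-- The Pochhammer symbol (rising factorial) `(c)ₙ = c (c + 1) ⋯ (c + n - 1)`. -/
def poch (c : ℂ) (n : ℕ) : ℂ := (ascPochhammer ℂ n).eval c

/-- The `n`-th Taylor coefficient `∏ᵢ (aᵢ)ₙ / (∏ⱼ (bⱼ)ₙ · n!)` of the generalized hypergeometric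
series with upper parameters `a` and lower parameters `b` (none of which may be a non-positive
integer). -/
def pFqCoeff (a b : Multiset ℂ) (n : ℕ) : ℂ :=
  (a.map (fun c => poch c n)).prod / ((b.map (fun c => poch c n)).prod * (n ! : ℂ))

/-- The cut plane `ℂ \ [1, ∞)`. -/
def cutPlane : Set ℂ := {z : ℂ | ¬ (z.im = 0 ∧ 1 ≤ z.re)}

/-- `F` is the generalized hypergeometric function `z ↦ pFq(a; b; z)`, where `p` and `q` are the
numbers of upper and lower parameters: `F` is the sum of the (convergent) hypergeometric series
for all `z` if `p ≤ q`, and for `‖z‖ < 1` otherwise, and in the case `p = q + 1` it is holomorphic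
on `ℂ \ [1, ∞)`, so that it is there the analytic continuation of the series. -/
structure IsPFq (a b : Multiset ℂ) (F : ℂ → ℂ) : Prop where
  hasSum : ∀ z : ℂ, (a.card ≤ b.card ∨ ‖z‖ < 1) →
    HasSum (fun n : ℕ => pFqCoeff a b n * z ^ n) (F z)
  differentiableOn : a.card = b.card + 1 → DifferentiableOn ℂ F cutPlane

/-- For `p ≤ q` the function is determined on all of `ℂ`. -/
theorem IsPFq.eq_of_card_le {a b : Multiset ℂ} {F G : ℂ → ℂ} (hF : IsPFq a b F)
    (hG : IsPFq a b G) (h : a.card ≤ b.card) : F = G := by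
  funext z
  exact (hF.hasSum z (Or.inl h)).unique (hG.hasSum z (Or.inl h))

theorem isOpen_cutPlane : IsOpen cutPlane := by
  have : IsClosed {z : ℂ | z.im = 0 ∧ 1 ≤ z.re} :=
    (isClosed_eq Complex.continuous_im continuous_const).inter
      (isClosed_le continuous_const Complex.continuous_re)
  exact this.isOpen_compl

theorem starConvex_cutPlane : StarConvex ℝ 0 cutPlane := by
  rw [starConvex_zero_iff]
  rintro z hz t ht0 ht1 ⟨h1, h2⟩
  apply hz
  simp only [Complex.real_smul, Complex.mul_im, Complex.ofReal_re, Complex.ofReal_im, zero_mul,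
    add_zero, Complex.mul_re, sub_zero, mul_eq_zero] at h1 h2
  rcases h1 with h1 | h1
  · subst h1; norm_num at h2
  · refine ⟨h1, ?_⟩
    by_contra! h
    rcases le_or_gt z.re 0 with h0 | h0 <;> nlinarith

/-- For `p = q + 1` the function is determined on `ℂ \ [1, ∞)`. -/
theorem IsPFq.eqOn_cutPlane {a b : Multiset ℂ} {F G : ℂ → ℂ} (hF : IsPFq a b F)
    (hG : IsPFq a b G) (h : a.card = b.card + 1) : Set.EqOn F G cutPlane := by
  have h0 : (0 : ℂ) ∈ cutPlane := by simp [cutPlane]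
  refine ((hF.differentiableOn h).analyticOnNhd isOpen_cutPlane).eqOn_of_preconnected_of_eventuallyEq
    ((hG.differentiableOn h).analyticOnNhd isOpen_cutPlane)
    (starConvex_cutPlane.isPathConnected h0).isConnected.isPreconnected h0 ?_
  filter_upwards [Metric.ball_mem_nhds (0 : ℂ) one_pos] with z hz
  have hz' : ‖z‖ < 1 := by simpa using hz
  exact (hF.hasSum z (Or.inr hz')).unique (hG.hasSum z (Or.inr hz'))

/-- The generalized hypergeometric function `pFq(a; b; z)`, a function singled out by `IsPFq a b`
(on `ℂ` if `p ≤ q`, on `ℂ \ [1, ∞)` if `p = q + 1`). -/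
def pFq (a b : Multiset ℂ) : ℂ → ℂ := Classical.epsilon (IsPFq a b)

section Parameters

variable {r : ℕ}

/-- `(f)_𝐦 = (f₁)_{m₁} ⋯ (f_r)_{m_r}`. -/
def vecPoch (f : Fin r → ℂ) (m : Fin r → ℕ) : ℂ := ∏ j, poch (f j) (m j)

/-- The coefficient `σᵢ` of `xⁱ` in `(f₁ + x)_{m₁} ⋯ (f_r + x)_{m_r}`. -/
def sigmaCoeff (f : Fin r → ℂ) (m : Fin r → ℕ) (i : ℕ) : ℂ :=
  (∏ j, (ascPochhammer ℂ (m j)).comp (Polynomial.C (f j) + Polynomial.X)).coeff i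

/-- The number `C_{k,r}(f) = (1 / (f)_𝐦) ∑_{i=k}^{m} σᵢ S(i, k)`, with `S(i, k)` the Stirling
numbers of the second kind. -/
def cCoeff (f : Fin r → ℂ) (m : Fin r → ℕ) (k : ℕ) : ℂ :=
  1 / vecPoch f m *
    ∑ i ∈ Finset.Icc k (∑ j, m j), sigmaCoeff f m i * (Nat.stirlingSecond i k : ℂ)

/-- The polynomial `R_{m-1}(t) = ∑_{k=0}^{m} (-1)ᵏ (b)ₖ C_{k,r} (1 - t - k)_{m-1}`, where
`m = m₁ + ⋯ + m_r`. -/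
def redPoly (b : ℂ) (f : Fin r → ℂ) (m : Fin r → ℕ) : Polynomial ℂ :=
  ∑ k ∈ Finset.range (∑ j, m j + 1),
    Polynomial.C (poch b k * (-1) ^ k * cCoeff f m k) *
      (ascPochhammer ℂ (∑ j, m j - 1)).comp (1 - Polynomial.X - Polynomial.C (k : ℂ))

/-- The parameter vector `f = (f₁, …, f_r)`. -/
def params (f : Fin r → ℂ) : Multiset ℂ := Finset.univ.val.map f

/-- The parameter vector `f + 𝐦 = (f₁ + m₁, …, f_r + m_r)`. -/
def shiftedParams (f : Fin r → ℂ) (m : Fin r → ℕ) : Multiset ℂ :=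
  Finset.univ.val.map (fun j => f j + (m j : ℂ))

end Parameters

end HypergeomCorollary

end

open scoped Nat

noncomputable section

namespace HypergeomCorollary

/-! ### Pochhammer symbols, Stirling expansion and the binomial transform of the coefficients -/

section Algebra

open Finset

/-! Let `c n` be the coefficients on the left without `(a)ₙ / n!`. Expanding around `x / (x - 1)`
(Euler) or multiplying by `e⁻ˣ` replaces `c` by its alternating binomial transform, so both
identities reduce to computing that transform.

Since `(f + m)ₙ / (f)ₙ = (f + n)ₘ / (f)ₘ`, `c n` is `(b)ₙ / (b + m)ₙ` times a polynomial in `n`.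
Stirling numbers expand that polynomial in falling factorials with coefficients `C_{k,r}`, and
Chu-Vandermonde transforms each term. For `n ≥ 1` the result is `n! R(-n) / ((b + m)ₙ (m - 1)!)`. At
`n = 0` this expression is `1 - A`, `A = (b)ₘ / (f)ₘ`, while the transform is `1`: hence the
constant `A` (`binomTransform_lhsSeq`). Factoring `R(-n) = R(0) ∏ (λ + n) / λ` gives the parameters
`λ + 1` over `λ`.

The right-hand series is continued by an Euler integral and the operators `λ + z d/dz`. The
left-hand function is then defined by the identity itself and matched with its series near `0`. -/

theorem poch_zero (c : ℂ) : poch c 0 = 1 := by simp [poch]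

theorem poch_succ (c : ℂ) (n : ℕ) : poch c (n + 1) = poch c n * (c + n) :=
  ascPochhammer_succ_eval n c

theorem poch_succ_left (c : ℂ) (n : ℕ) : poch c (n + 1) = c * poch (c + 1) n := by
  simp [poch, ascPochhammer_succ_left, Polynomial.eval_comp]

theorem poch_add (c : ℂ) (n k : ℕ) : poch c (n + k) = poch c n * poch (c + n) k := by
  induction k with
  | zero => simp [poch_zero]
  | succ k ih => rw [← add_assoc, poch_succ, ih, poch_succ]; push_cast; ring

theorem poch_ne_zero {c : ℂ} (hc : ∀ n : ℕ, c ≠ -(n : ℂ)) (n : ℕ) : poch c n ≠ 0 := by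
  induction n with
  | zero => simp [poch_zero]
  | succ n ih =>
    rw [poch_succ]
    refine mul_ne_zero ih fun h => hc n ?_
    linear_combination h

theorem poch_one (n : ℕ) : poch 1 n = n ! := by
  induction n with
  | zero => simp [poch_zero]
  | succ n ih => rw [poch_succ, ih, Nat.factorial_succ]; push_cast; ring

theorem ne_neg_nat_add {c : ℂ} (hc : ∀ n : ℕ, c ≠ -(n : ℂ)) (k : ℕ) :
    ∀ n : ℕ, c + k ≠ -(n : ℂ) := by
  intro n h
  apply hc (n + k)
  push_cast
  linear_combination h

theorem ne_zero_of_ne_neg_nat {c : ℂ} (hc : ∀ n : ℕ, c ≠ -(n : ℂ)) : c ≠ 0 := by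
  simpa using hc 0

/-- `(c + m)ₙ / (c)ₙ = (c + n)ₘ / (c)ₘ`. -/
theorem poch_shift_div {c : ℂ} (hc : ∀ n : ℕ, c ≠ -(n : ℂ)) (m n : ℕ) :
    poch (c + m) n / poch c n = poch (c + n) m / poch c m := by
  rw [div_eq_div_iff (poch_ne_zero hc n) (poch_ne_zero hc m), mul_comm, ← poch_add, mul_comm _ (poch c n),
    ← poch_add, add_comm]

theorem poch_succ_param_div {c : ℂ} (hc : ∀ n : ℕ, c ≠ -(n : ℂ)) (n : ℕ) :
    poch (c + 1) n / poch c n = (c + n) / c := by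
  simpa [poch_succ, poch_zero] using poch_shift_div hc 1 n

/-- The alternating binomial transform of a sequence. -/
def binomTransform (c : ℕ → ℂ) (n : ℕ) : ℂ :=
  ∑ k ∈ range (n + 1), (-1) ^ k * (n.choose k : ℂ) * c k

/-- Pascal's rule; it drives the induction for Chu-Vandermonde. -/
theorem binomTransform_succ (c : ℕ → ℂ) (n : ℕ) :
    binomTransform c (n + 1) = binomTransform c n - binomTransform (fun k => c (k + 1)) n := by
  have h1 : binomTransform c n = ∑ k ∈ range (n + 2), (-1) ^ k * (n.choose k : ℂ) * c k := by
    rw [sum_range_succ _ (n + 1)]; simp [binomTransform]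
  rw [h1, binomTransform, binomTransform, sum_range_succ' _ (n + 1), sum_range_succ' _ (n + 1)]
  simp only [Nat.choose_succ_succ]
  rw [add_sub_right_comm, ← sum_sub_distrib]
  congr 1
  · refine sum_congr rfl fun k _ => ?_
    push_cast
    ring
  · simp

theorem binomTransform_const_mul (x : ℂ) (c : ℕ → ℂ) (n : ℕ) :
    binomTransform (fun k => x * c k) n = x * binomTransform c n := by
  rw [binomTransform, binomTransform, mul_sum]
  exact sum_congr rfl fun k _ => by ring

/-- The Chu-Vandermonde summation. -/
theorem binomTransform_poch_div (β : ℂ) {γ : ℂ} (hγ : ∀ n : ℕ, γ ≠ -(n : ℂ)) (n : ℕ) :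
    binomTransform (fun k => poch β k / poch γ k) n = poch (γ - β) n / poch γ n := by
  induction n generalizing β γ with
  | zero => simp [binomTransform, poch_zero]
  | succ n ih =>
    have hγ1 : ∀ n : ℕ, γ + 1 ≠ -(n : ℂ) := by simpa using ne_neg_nat_add hγ 1
    have h0 := ne_zero_of_ne_neg_nat hγ
    -- The shifted sequence is of the same kind with both parameters raised by one, so `γ - β` is
    -- unchanged.
    have e : (fun k => poch β (k + 1) / poch γ (k + 1)) =
        fun k => (β / γ) * (poch (β + 1) k / poch (γ + 1) k) := by
      funext k
      rw [poch_succ_left, poch_succ_left, mul_div_mul_comm]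
    rw [binomTransform_succ, e, binomTransform_const_mul, ih _ hγ, ih _ hγ1]
    have h1 := poch_ne_zero hγ n
    have h2 := poch_ne_zero hγ1 n
    have h3 : γ * poch (γ + 1) n = poch γ n * (γ + n) := by rw [← poch_succ_left, poch_succ]
    have h4 : γ + n ≠ 0 := by
      intro h; exact hγ n (by linear_combination h)
    rw [poch_succ, poch_succ, add_sub_add_right_eq_sub, div_mul_div_comm, h3]
    field_simp
    ring

/-- The falling factorial kills the first `k` terms and is absorbed by the binomial coefficient in
the others. -/
theorem binomTransform_descFactorial (c : ℕ → ℂ) (k n : ℕ) :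
    binomTransform (fun l => (l.descFactorial k : ℂ) * c l) (k + n) =
      (-1) ^ k * ((k + n).descFactorial k : ℂ) * binomTransform (fun l => c (k + l)) n := by
  rw [binomTransform, add_assoc, sum_range_add, sum_eq_zero, zero_add, binomTransform, mul_sum]
  · refine sum_congr rfl fun l hl => ?_
    have hl' : l ≤ n := by simpa [Nat.lt_succ_iff] using hl
    have h := Nat.choose_mul (n := k + n) (k := k + l) (s := k) (by omega)
    have h2 : ((k + n).choose (k + l) * (k + l).descFactorial k : ℕ) =
        (k + n).descFactorial k * n.choose l := by
      rw [Nat.descFactorial_eq_factorial_mul_choose, Nat.descFactorial_eq_factorial_mul_choose]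
      rw [show k + n - k = n by omega, show k + l - k = l by omega] at h
      linear_combination (k !) * h
    have h3 : ((k + n).choose (k + l) : ℂ) * ((k + l).descFactorial k : ℂ) =
        ((k + n).descFactorial k : ℂ) * (n.choose l : ℂ) := by exact_mod_cast h2
    rw [pow_add]
    linear_combination (-1) ^ k * (-1) ^ l * c (k + l) * h3
  · intro l hl
    rw [Nat.descFactorial_of_lt (mem_range.1 hl)]
    simp

theorem binomTransform_descFactorial_of_lt (c : ℕ → ℂ) {k n : ℕ} (h : n < k) :
    binomTransform (fun l => (l.descFactorial k : ℂ) * c l) n = 0 := by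
  refine sum_eq_zero fun l hl => ?_
  simp [Nat.descFactorial_of_lt (show l < k by simp at hl; omega)]

theorem pow_eq_sum_stirlingSecond (n i : ℕ) :
    (n : ℂ) ^ i = ∑ k ∈ range (i + 1), (Nat.stirlingSecond i k : ℂ) * (n.descFactorial k : ℂ) := by
  induction i with
  | zero => simp
  | succ i ih =>
    rw [sum_range_succ' _ (i + 1)]
    simp only [Nat.stirlingSecond_succ_succ, Nat.stirlingSecond_succ_zero]
    have key : ∀ k, (n : ℂ) * n.descFactorial k = n.descFactorial (k + 1) + k * n.descFactorial k := by
      intro k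
      rw [Nat.descFactorial_succ]
      rcases le_or_gt k n with h | h
      · push_cast [Nat.cast_sub h]; ring
      · rw [Nat.descFactorial_of_lt h]; simp
    -- An index shift: the bottom term has the factor `0`, the top one the factor `S(i, i + 1) = 0`.
    have h2 : ∑ k ∈ range (i + 1), ((k : ℂ) + 1) * (Nat.stirlingSecond i (k + 1) : ℂ) *
        (n.descFactorial (k + 1) : ℂ) =
        ∑ k ∈ range (i + 1), (k : ℂ) * (Nat.stirlingSecond i k : ℂ) * (n.descFactorial k : ℂ) := by
      have := sum_range_succ' (fun k => (k : ℂ) * (Nat.stirlingSecond i k : ℂ) *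
        (n.descFactorial k : ℂ)) (i + 1)
      rw [sum_range_succ, Nat.stirlingSecond_eq_zero_of_lt (Nat.lt_succ_self i)] at this
      simpa using this.symm
    rw [pow_succ, ih, sum_mul]
    simp only [Nat.cast_zero, zero_mul, add_zero]
    push_cast
    simp only [add_mul _ (Nat.stirlingSecond i _ : ℂ), sum_add_distrib] at h2 ⊢
    rw [h2, ← sum_add_distrib]
    refine sum_congr rfl fun k _ => ?_
    linear_combination (Nat.stirlingSecond i k : ℂ) * key k

section
variable {r : ℕ} (f : Fin r → ℂ) (m : Fin r → ℕ)

/-- The polynomial `(f₁ + X)_{m₁} ⋯ (f_r + X)_{m_r}`. -/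
def numerPoly : Polynomial ℂ :=
  ∏ j, (ascPochhammer ℂ (m j)).comp (Polynomial.C (f j) + Polynomial.X)

theorem numerPoly_eval (x : ℂ) : (numerPoly f m).eval x = ∏ j, poch (f j + x) (m j) := by
  simp [numerPoly, Polynomial.eval_prod, Polynomial.eval_comp, poch]

theorem numerPoly_factor_monic (c : ℂ) (k : ℕ) :
    ((ascPochhammer ℂ k).comp (Polynomial.C c + Polynomial.X)).Monic := by
  rw [add_comm]
  exact (monic_ascPochhammer ℂ k).comp_X_add_C c

theorem numerPoly_monic : (numerPoly f m).Monic :=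
  Polynomial.monic_prod_of_monic _ _ fun _ _ => numerPoly_factor_monic _ _

theorem numerPoly_natDegree : (numerPoly f m).natDegree = ∑ j, m j := by
  rw [numerPoly, Polynomial.natDegree_prod_of_monic _ _ fun _ _ => numerPoly_factor_monic _ _]
  refine sum_congr rfl fun j _ => ?_
  rw [Polynomial.natDegree_comp, ascPochhammer_natDegree, add_comm, Polynomial.natDegree_X_add_C,
    mul_one]

theorem cCoeff_sum : cCoeff f m (∑ j, m j) = 1 / vecPoch f m := by
  have : sigmaCoeff f m (∑ j, m j) = 1 := by
    change (numerPoly f m).coeff _ = 1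
    rw [← numerPoly_natDegree f m]
    exact numerPoly_monic f m
  simp [cCoeff, this, Nat.stirlingSecond_self]

/-- This is the role of the `C_{k,r}`: coordinates of the normalised numerator in the falling
factorial basis. -/
theorem numerPoly_eval_div (n : ℕ) : (numerPoly f m).eval (n : ℂ) / vecPoch f m =
    ∑ k ∈ range (∑ j, m j + 1), cCoeff f m k * (n.descFactorial k : ℂ) := by
  rw [Polynomial.eval_eq_sum_range, numerPoly_natDegree, div_eq_inv_mul]
  simp only [cCoeff, one_div, mul_assoc]
  rw [← mul_sum]
  congr 1
  simp only [pow_eq_sum_stirlingSecond, mul_sum, sum_mul]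
  have : ∀ i, (numerPoly f m).coeff i = sigmaCoeff f m i := fun _ => rfl
  simp only [this]
  rw [sum_comm' (t' := range (∑ j, m j + 1)) (s' := fun k => Icc k (∑ j, m j))]
  · refine sum_congr rfl fun k _ => sum_congr rfl fun i _ => by ring
  · intro x y; simp only [mem_range, mem_Icc]; omega

/-- The coefficients of the function on the left-hand sides, without the Pochhammer symbol
of the free parameter and the factorial. -/
def lhsSeq (b : ℂ) (n : ℕ) : ℂ :=
  poch b n / poch (b + (∑ j, m j : ℕ)) n * ((numerPoly f m).eval (n : ℂ) / vecPoch f m)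

/-- Both sides equal `(k + n)! (n + M - 1)! / n!`. -/
theorem poch_mul_descFactorial {M k n : ℕ} (hM : 0 < M) :
    ((k + n).descFactorial k : ℂ) * poch M n * ((M - 1)! : ℂ) =
      ((k + n)! : ℂ) * poch (1 + n) (M - 1) := by
  obtain ⟨M, rfl⟩ : ∃ N, M = N + 1 := ⟨M - 1, by omega⟩
  have h1 : ((k + n)! : ℂ) = (n ! : ℂ) * ((k + n).descFactorial k : ℂ) := by
    have := Nat.factorial_mul_descFactorial (n := k + n) (k := k) (by omega)
    rw [Nat.add_sub_cancel_left] at this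
    exact_mod_cast this.symm
  have h2 : (M ! : ℂ) * poch ((M + 1 : ℕ) : ℂ) n = (n ! : ℂ) * poch (1 + n) M := by
    rw [← poch_one, ← poch_one, ← poch_add, Nat.cast_succ, add_comm (M : ℂ) 1, ← poch_add, add_comm]
  rw [h1, Nat.add_sub_cancel]
  linear_combination ((k + n).descFactorial k : ℂ) * h2

theorem poch_neg_nat_eq_zero {j n : ℕ} (h : j < n) : poch (-(j : ℂ)) n = 0 :=
  ascPochhammer_eval_neg_coe_nat_of_lt h

theorem poch_neg_nat_self (n : ℕ) : poch (-(n : ℂ)) n = (-1) ^ n * (n ! : ℂ) := by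
  induction n with
  | zero => simp [poch_zero]
  | succ n ih =>
    rw [poch_succ_left, Nat.factorial_succ,
      show -((n + 1 : ℕ) : ℂ) + 1 = -(n : ℂ) by push_cast; ring, ih]
    push_cast
    ring

theorem redPoly_eval (b x : ℂ) : (redPoly b f m).eval (-x) =
    ∑ k ∈ range (∑ j, m j + 1), poch b k * (-1) ^ k * cCoeff f m k *
      poch (1 + x - k) (∑ j, m j - 1) := by
  simp [redPoly, Polynomial.eval_finsetSum, Polynomial.eval_comp, poch]

theorem binomTransform_sum {ι : Type*} (s : Finset ι) (c : ι → ℕ → ℂ) (n : ℕ) :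
    binomTransform (fun l => ∑ i ∈ s, c i l) n = ∑ i ∈ s, binomTransform (c i) n := by
  simp only [binomTransform, mul_sum]
  exact sum_comm

/-- After the shift by `k`, Chu-Vandermonde applies with parameter difference `M` for every `k`; the
results therefore combine into a single polynomial. -/
theorem binomTransform_descFactorial_poch_div {b : ℂ} {M : ℕ} (hM : 0 < M)
    (hb : ∀ n : ℕ, b + M ≠ -(n : ℂ)) {n k : ℕ} (hn : 0 < n) (hk : k ≤ M) :
    binomTransform (fun l => (l.descFactorial k : ℂ) * (poch b l / poch (b + M) l)) n =
      (n ! : ℂ) / (poch (b + M) n * ((M - 1)! : ℂ)) *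
        (poch b k * (-1) ^ k * poch (1 + n - k) (M - 1)) := by
  rcases lt_or_ge n k with h | h
  -- Both sides vanish: on the right `k - 1 - n < M - 1`, by `k ≤ M` and `0 < n`. This fails for `n
  -- = 0`, `k = M`, the source of the constant `A`.
  · rw [binomTransform_descFactorial_of_lt _ h,
      show (1 : ℂ) + n - k = -((k - 1 - n : ℕ) : ℂ) by
        rw [Nat.cast_sub (by omega), Nat.cast_sub (by omega)]; push_cast; ring,
      poch_neg_nat_eq_zero (by omega)]
    ring
  · obtain ⟨n, rfl⟩ := Nat.exists_eq_add_of_le h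
    have e : (fun l => poch b (k + l) / poch (b + M) (k + l)) = fun l =>
        (poch b k / poch (b + M) k) * (poch (b + k) l / poch (b + M + k) l) := by
      funext l
      rw [poch_add, poch_add, mul_div_mul_comm]
    rw [binomTransform_descFactorial, e, binomTransform_const_mul,
      binomTransform_poch_div _ (ne_neg_nat_add hb k), poch_add (b + M) k n,
      show b + M + k - (b + k) = M by ring,
      show (1 : ℂ) + (k + n : ℕ) - k = 1 + n by push_cast; ring]
    have h1 := poch_ne_zero hb k
    have h2 := poch_ne_zero (ne_neg_nat_add hb k) n
    have h3 : ((M - 1)! : ℂ) ≠ 0 := by exact_mod_cast Nat.factorial_ne_zero _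
    field_simp
    linear_combination poch b k * poch_mul_descFactorial (k := k) (n := n) hM

theorem vecPoch_ne_zero (hf : ∀ j, ∀ n : ℕ, f j ≠ -(n : ℂ)) : vecPoch f m ≠ 0 :=
  prod_ne_zero_iff.2 fun j _ => poch_ne_zero (hf j) _

theorem lhsSeq_zero (hf : ∀ j, ∀ n : ℕ, f j ≠ -(n : ℂ)) (b : ℂ) : lhsSeq f m b 0 = 1 := by
  have h : (numerPoly f m).eval ((0 : ℕ) : ℂ) = vecPoch f m := by
    simp [numerPoly_eval, vecPoch]
  rw [lhsSeq, h, div_self (vecPoch_ne_zero f m hf)]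
  simp [poch_zero]

/-- `(1 - k)_{m-1}` vanishes for `0 < k < m`, so only the terms `k = 0` and `k = m` survive. -/
theorem redPoly_eval_zero (hM : 0 < ∑ j, m j) (hf : ∀ j, ∀ n : ℕ, f j ≠ -(n : ℂ)) (b : ℂ) :
    (redPoly b f m).eval 0 =
      ((∑ j, m j - 1)! : ℂ) * (1 - poch b (∑ j, m j) / vecPoch f m) := by
  have hc0 : cCoeff f m 0 = 1 := by
    have := numerPoly_eval_div f m 0
    rw [sum_range_succ', sum_eq_zero fun k _ => by simp] at this
    have h0 := lhsSeq_zero f m hf 0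
    simp only [lhsSeq, poch_zero, div_one, one_mul] at h0
    rw [Nat.cast_zero] at this h0; rw [← h0, this]; simp
  have hcM := cCoeff_sum f m
  have h := redPoly_eval f m b 0
  generalize (∑ j, m j) = M at *
  obtain ⟨M, rfl⟩ : ∃ N, M = N + 1 := ⟨M - 1, by omega⟩
  rw [neg_zero, sum_range_succ, sum_range_succ', sum_eq_zero] at h
  · rw [h, hc0, hcM, Nat.add_sub_cancel,
      show (1 : ℂ) + 0 - (M + 1 : ℕ) = -(M : ℂ) by push_cast; ring, poch_neg_nat_self]
    simp only [poch_zero, Nat.cast_zero, add_zero, sub_zero, poch_one]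
    have : ((-1 : ℂ) ^ M) ^ 2 = 1 := by rw [← pow_mul, mul_comm, pow_mul]; simp
    linear_combination -(poch b (M + 1) * (M ! : ℂ) / vecPoch f m) * this
  · intro k hk
    rw [show (1 : ℂ) + 0 - (k + 1 : ℕ) = -(k : ℂ) by push_cast; ring,
      poch_neg_nat_eq_zero (by simpa using hk), mul_zero]

theorem binomTransform_lhsSeq (hM : 0 < ∑ j, m j) (hf : ∀ j, ∀ n : ℕ, f j ≠ -(n : ℂ)) {b : ℂ}
    (hb : ∀ n : ℕ, b + (∑ j, m j : ℕ) ≠ -(n : ℂ)) (n : ℕ) :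
    binomTransform (lhsSeq f m b) n =
      (if n = 0 then poch b (∑ j, m j) / vecPoch f m else 0) +
      (n ! : ℂ) / (poch (b + (∑ j, m j : ℕ)) n * ((∑ j, m j - 1)! : ℂ)) *
        (redPoly b f m).eval (-(n : ℂ)) := by
  rcases Nat.eq_zero_or_pos n with rfl | hn
  · have h3 : ((∑ j, m j - 1)! : ℂ) ≠ 0 := by exact_mod_cast Nat.factorial_ne_zero _
    have h0 : binomTransform (lhsSeq f m b) 0 = 1 := by simp [binomTransform, lhsSeq_zero f m hf]
    rw [h0, Nat.cast_zero, neg_zero, redPoly_eval_zero f m hM hf, poch_zero]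
    simp only [if_true, Nat.factorial_zero, Nat.cast_one]
    field_simp
    ring
  · have e : lhsSeq f m b = fun l => ∑ k ∈ range (∑ j, m j + 1), cCoeff f m k *
        ((l.descFactorial k : ℂ) * (poch b l / poch (b + (∑ j, m j : ℕ)) l)) := by
      funext l
      rw [lhsSeq, numerPoly_eval_div, mul_sum]
      exact sum_congr rfl fun k _ => by ring
    rw [if_neg hn.ne', zero_add, e, binomTransform_sum, redPoly_eval, mul_sum]
    refine sum_congr rfl fun k hk => ?_
    rw [binomTransform_const_mul,
      binomTransform_descFactorial_poch_div hM hb hn (by simp at hk; omega)]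
    ring

/-- Dividing by the value at `0` removes the leading coefficient and the signs. The zero polynomial
is covered, with an empty list of roots. -/
theorem eval_neg_eq_mul_prod_roots {p : Polynomial ℂ} (hp : ∀ l ∈ p.roots, l ≠ 0) (x : ℂ) :
    p.eval (-x) = p.eval 0 * (p.roots.map fun l => (l + x) / l).prod := by
  have key : ∀ y, p.eval y = p.leadingCoeff * (p.roots.map fun l => y - l).prod := by
    intro y
    conv_lhs => rw [(IsAlgClosed.splits p).eq_prod_roots]
    simp [Polynomial.eval_multiset_prod, Multiset.map_map]
  rw [key, key 0, mul_assoc, ← Multiset.prod_map_mul]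
  congr 2
  refine Multiset.map_congr rfl fun l hl => ?_
  have := hp l hl
  field_simp
  ring

/-- The coefficients of the functions on the right-hand sides, without the Pochhammer symbol
of the free parameter and the factorial. -/
def rhsSeq (γ : ℂ) (lam : Multiset ℂ) (n : ℕ) : ℂ :=
  (n ! : ℂ) / poch γ n * (lam.map fun l : ℂ => (l + n) / l).prod

/-- If `R` is identically zero, then `R(0) = 0` forces the factor `1 - A` to vanish, so no separate
case is needed. -/
theorem binomTransform_lhsSeq_eq_rhsSeq (hM : 0 < ∑ j, m j)
    (hf : ∀ j, ∀ n : ℕ, f j ≠ -(n : ℂ)) {b : ℂ}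
    (hb : ∀ n : ℕ, b + (∑ j, m j : ℕ) ≠ -(n : ℂ))
    (hR : ∀ l ∈ (redPoly b f m).roots, l ≠ 0) (n : ℕ) :
    binomTransform (lhsSeq f m b) n =
      (if n = 0 then poch b (∑ j, m j) / vecPoch f m else 0) +
      (1 - poch b (∑ j, m j) / vecPoch f m) *
        rhsSeq (b + (∑ j, m j : ℕ)) (redPoly b f m).roots n := by
  have h1 := poch_ne_zero hb n
  have h3 : ((∑ j, m j - 1)! : ℂ) ≠ 0 := by exact_mod_cast Nat.factorial_ne_zero _
  rw [binomTransform_lhsSeq f m hM hf hb, eval_neg_eq_mul_prod_roots hR,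
    redPoly_eval_zero f m hM hf, rhsSeq]
  congr 1
  generalize (Multiset.map (fun l : ℂ => (l + n) / l) _).prod = q
  generalize poch b (∑ j, m j) / vecPoch f m = A
  field_simp

theorem pFqCoeff_shifted (hf : ∀ j, ∀ n : ℕ, f j ≠ -(n : ℂ)) (b : ℂ) (n : ℕ) :
    pFqCoeff (b ::ₘ shiftedParams f m) ((b + (∑ j, m j : ℕ)) ::ₘ params f) n =
      lhsSeq f m b n / (n ! : ℂ) := by
  have h : ∏ j, poch (f j + m j) n / poch (f j) n = (numerPoly f m).eval (n : ℂ) / vecPoch f m := by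
    rw [numerPoly_eval, vecPoch, ← prod_div_distrib]
    exact prod_congr rfl fun j _ => poch_shift_div (hf j) _ _
  rw [lhsSeq, ← h, prod_div_distrib]
  simp only [pFqCoeff, shiftedParams, params, Multiset.map_cons, Multiset.prod_cons,
    Multiset.map_map, Function.comp_def]
  change _ * (∏ j, _) / (_ * (∏ j, _) * _) = _
  rw [div_mul_div_comm, div_div]

theorem pFqCoeff_cons (a : ℂ) (s t : Multiset ℂ) (n : ℕ) :
    pFqCoeff (a ::ₘ s) t n = poch a n * pFqCoeff s t n := by
  simp [pFqCoeff, mul_div_assoc]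

theorem pFqCoeff_one_cons {lam : Multiset ℂ} (hlam : ∀ l ∈ lam, ∀ n : ℕ, l ≠ -(n : ℂ)) (γ : ℂ)
    (n : ℕ) : pFqCoeff (1 ::ₘ lam.map (fun l => l + 1)) (γ ::ₘ lam) n =
      rhsSeq γ lam n / (n ! : ℂ) := by
  have h : (lam.map fun l : ℂ => (l + n) / l).prod =
      ((lam.map (fun l => l + 1)).map fun c => poch c n).prod /
        (lam.map fun c => poch c n).prod := by
    rw [Multiset.map_map, ← Multiset.prod_map_div]
    congr 1
    exact Multiset.map_congr rfl fun l hl => (poch_succ_param_div (hlam l hl) n).symm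
  rw [rhsSeq, h, pFqCoeff, Multiset.map_cons, Multiset.prod_cons, Multiset.map_cons,
    Multiset.prod_cons, poch_one, div_mul_div_comm, div_div]

end

end Algebra

/-! ### Analytic continuation to the cut plane -/

section Continuation

open Filter Topology Set

theorem mem_cutPlane_of_norm_lt_one {z : ℂ} (hz : ‖z‖ < 1) : z ∈ cutPlane := fun h =>
  absurd (h.2.trans ((Complex.re_le_norm z).trans_lt hz).le) (by
    have := (Complex.re_le_norm z).trans_lt hz
    linarith [h.2])

theorem zero_mem_cutPlane : (0 : ℂ) ∈ cutPlane := mem_cutPlane_of_norm_lt_one (by simp)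

/-- A power series that converges near `0` to a function holomorphic on the cut plane converges to
it on the unit disc. -/
theorem hasSum_of_eventually_of_differentiableOn {F : ℂ → ℂ} {u : ℕ → ℂ}
    (hF : DifferentiableOn ℂ F cutPlane)
    (h : ∀ᶠ z in 𝓝 (0 : ℂ), HasSum (fun n => u n * z ^ n) (F z)) {z : ℂ} (hz : ‖z‖ < 1) :
    HasSum (fun n => u n * z ^ n) (F z) := by
  have h1 : HasFPowerSeriesAt F (FormalMultilinearSeries.ofScalars ℂ u) 0 := by
    rw [hasFPowerSeriesAt_iff]
    simpa [FormalMultilinearSeries.coeff_ofScalars, mul_comm] using h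
  obtain ⟨R, hR1, hR2⟩ := exists_between hz
  lift R to NNReal using (norm_nonneg z).trans hR1.le
  have hR0 : 0 < R := by
    have := (norm_nonneg z).trans_lt hR1
    exact_mod_cast this
  have h2 : HasFPowerSeriesOnBall F (cauchyPowerSeries F 0 R) 0 R :=
    (hF.mono fun w hw => mem_cutPlane_of_norm_lt_one
      (lt_of_le_of_lt (by simpa using hw) hR2)).hasFPowerSeriesOnBall hR0
  rw [← h1.eq_formalMultilinearSeries h2.hasFPowerSeriesAt] at h2
  have := h2.hasSum (y := z) (by
    rw [Metric.mem_eball, edist_zero_right]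
    exact_mod_cast (show ‖z‖₊ < R from hR1))
  simpa [FormalMultilinearSeries.ofScalars, mul_comm] using this

/-- The power series with coefficients `u` converges in the unit disc and continues
holomorphically to the cut plane. -/
def HasCutContinuation (u : ℕ → ℂ) : Prop :=
  ∃ F : ℂ → ℂ, DifferentiableOn ℂ F cutPlane ∧
    ∀ z : ℂ, ‖z‖ < 1 → HasSum (fun n => u n * z ^ n) (F z)

theorem HasCutContinuation.const_mul {u : ℕ → ℂ} (h : HasCutContinuation u) (x : ℂ) :
    HasCutContinuation fun n => x * u n := by
  obtain ⟨F, hF, h⟩ := h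
  refine ⟨fun z => x * F z, hF.const_mul x, fun z hz => ?_⟩
  simpa [mul_assoc] using (h z hz).mul_left x

theorem hasSum_natCast_mul_of_hasSum {F : ℂ → ℂ} {u : ℕ → ℂ}
    (h : ∀ z : ℂ, ‖z‖ < 1 → HasSum (fun n => u n * z ^ n) (F z)) {z : ℂ} (hz : ‖z‖ < 1) :
    HasSum (fun n : ℕ => (n : ℂ) * u n * z ^ n) (z * deriv F z) := by
  obtain ⟨R, hR1, hR2⟩ := exists_between hz
  have hR0 : 0 ≤ R := (norm_nonneg z).trans hR1.le
  have hs : Summable fun n => ‖u n‖ * R ^ n := by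
    have := (h (R : ℂ) (by simpa [abs_of_nonneg hR0] using hR2)).summable.norm
    simpa [abs_of_nonneg hR0] using this
  have hzR : z ∈ Metric.ball (0 : ℂ) R := by simpa using hR1
  have key := Complex.hasSum_deriv_of_summable_norm (F := fun n z => u n * z ^ n) hs
    (fun n => by fun_prop) Metric.isOpen_ball (fun n w hw => by
      have hw : ‖w‖ ≤ R := le_of_lt (by simpa using hw)
      rw [norm_mul, norm_pow]; gcongr) hzR
  have e : deriv (fun w => ∑' n, u n * w ^ n) z = deriv F z := by
    refine Filter.EventuallyEq.deriv_eq ?_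
    filter_upwards [Metric.isOpen_ball.mem_nhds hzR] with w hw
    exact (h w (lt_trans (by simpa using hw) hR2)).tsum_eq
  rw [e] at key
  refine (congrArg (fun g : ℕ → ℂ => HasSum g _) (funext fun n => ?_)).mp (key.mul_left z)
  rcases n with _ | n
  · simp
  · simp
    ring

/-- On functions this is the operator `x + z d/dz`, which preserves holomorphy on the cut plane. -/
theorem HasCutContinuation.add_natCast_mul {u : ℕ → ℂ} (h : HasCutContinuation u) (x : ℂ) :
    HasCutContinuation fun n => (x + n) * u n := by
  obtain ⟨F, hF, h⟩ := h
  refine ⟨fun z => x * F z + z * deriv F z, ?_, fun z hz => ?_⟩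
  · exact (hF.const_mul x).add (differentiableOn_id.mul (hF.deriv isOpen_cutPlane))
  · have := ((h z hz).mul_left x).add (hasSum_natCast_mul_of_hasSum h hz)
    refine (congrArg (fun g : ℕ → ℂ => HasSum g _) (funext fun n => ?_)).mp this
    ring

theorem hasSum_poch_div_factorial (a : ℂ) {w : ℂ} (hw : ‖w‖ < 1) :
    HasSum (fun n => poch a n / (n ! : ℂ) * w ^ n) ((1 - w) ^ (-a)) := by
  have h := (Complex.one_div_one_sub_cpow_hasFPowerSeriesOnBall_zero a).hasSum (y := w) (by
    rw [Metric.mem_eball, edist_zero_right, enorm_eq_nnnorm]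
    exact_mod_cast (show ‖w‖₊ < 1 from hw))
  have e : ∀ n : ℕ, Ring.choose (a + n - 1) n = poch a n / (n ! : ℂ) := by
    intro n
    rw [Ring.choose_eq_smul, Polynomial.descPochhammer_smeval_eq_ascPochhammer,
      Polynomial.ascPochhammer_smeval_cast, Polynomial.ascPochhammer_smeval_eq_eval, poch,
      show a + n - 1 - n + 1 = a by ring, div_eq_inv_mul]
    simp
  rw [Complex.cpow_neg, ← one_div]
  simpa [FormalMultilinearSeries.ofScalars, e, mul_comm] using h

theorem one_sub_mul_mem_slitPlane {z : ℂ} (hz : z ∈ cutPlane) {t : ℝ} (ht : t ∈ Icc (0 : ℝ) 1) :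
    1 - z * (t : ℂ) ∈ Complex.slitPlane := by
  rw [Complex.mem_slitPlane_iff]
  by_contra! h
  obtain ⟨h1, h2⟩ := h
  simp at h1 h2
  have h3 : z.im = 0 ∧ t ≠ 0 := by
    rcases h2 with h2 | h2
    · refine ⟨h2, ?_⟩; rintro rfl; norm_num at h1
    · subst h2; norm_num at h1
  refine hz ⟨h3.1, ?_⟩
  by_contra! h4
  have := ht.1; have := ht.2
  nlinarith [lt_of_le_of_ne ht.1 h3.2.symm]

/-- `Re c > 2` makes the kernel continuous up to the endpoint `0`, so compactness supplies all
integrable bounds below. -/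
theorem continuousOn_eulerKernel (a : ℂ) {c : ℂ} (hc : 2 < c.re) :
    ContinuousOn (fun p : ℂ × ℝ => (p.2 : ℂ) ^ (c - 2) * (1 - p.1 * ((1 - p.2 : ℝ) : ℂ)) ^ a)
      (cutPlane ×ˢ Icc (0 : ℝ) 1) := by
  refine ContinuousOn.mul ?_ (ContinuousOn.cpow_const (by fun_prop) fun p hp => ?_)
  · exact ((Complex.continuous_ofReal_cpow_const (by simpa using hc)).comp
      continuous_snd).continuousOn
  · exact one_sub_mul_mem_slitPlane hp.1 ⟨by linarith [hp.2.2], by linarith [hp.2.1]⟩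

theorem differentiableOn_eulerIntegral (a : ℂ) {c : ℂ} (hc : 2 < c.re) :
    DifferentiableOn ℂ (fun z => ∫ x in (0 : ℝ)..1,
      (x : ℂ) ^ (c - 2) * (1 - z * ((1 - x : ℝ) : ℂ)) ^ (-a)) cutPlane := by
  intro z hz
  obtain ⟨ε, hε, hball⟩ := Metric.nhds_basis_closedBall.mem_iff.1 (isOpen_cutPlane.mem_nhds hz)
  let K' : ℂ → ℝ → ℂ := fun z x => (a * ((1 - x : ℝ) : ℂ)) * ((x : ℂ) ^ (c - 2) *
    (1 - z * ((1 - x : ℝ) : ℂ)) ^ (-a - 1))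
  have hcontK' : ContinuousOn (fun p : ℂ × ℝ => K' p.1 p.2) (cutPlane ×ˢ Icc (0 : ℝ) 1) :=
    ContinuousOn.mul (by fun_prop) (continuousOn_eulerKernel (-a - 1) hc)
  have hslice : ∀ {f : ℂ × ℝ → ℂ}, ContinuousOn f (cutPlane ×ˢ Icc (0 : ℝ) 1) → ∀ w ∈ cutPlane,
      IntervalIntegrable (fun x => f (w, x)) MeasureTheory.volume 0 1 := by
    intro f hf w hw
    refine ContinuousOn.intervalIntegrable ?_
    rw [uIcc_of_le zero_le_one]
    exact hf.comp (by fun_prop) fun x hx => ⟨hw, hx⟩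
  obtain ⟨C, hC⟩ := ((isCompact_closedBall z ε).prod (isCompact_Icc (a := (0 : ℝ)) (b := 1))
    ).exists_bound_of_continuousOn (hcontK'.mono (prod_mono hball subset_rfl))
  have hsub : ∀ x ∈ uIoc (0 : ℝ) 1, x ∈ Icc (0 : ℝ) 1 := fun x hx => by
    rw [uIoc_of_le zero_le_one] at hx
    exact ⟨hx.1.le, hx.2⟩
  refine (intervalIntegral.hasDerivAt_integral_of_dominated_loc_of_deriv_le (F' := K')
    (bound := fun _ => C) (Metric.closedBall_mem_nhds z hε) ?_
    (hslice (continuousOn_eulerKernel (-a) hc) z hz) ?_ ?_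
    intervalIntegrable_const ?_).2.differentiableAt.differentiableWithinAt
  · filter_upwards [isOpen_cutPlane.mem_nhds hz] with w hw
    exact (hslice (continuousOn_eulerKernel (-a) hc) w hw).def'.aestronglyMeasurable
  · exact (hslice hcontK' z hz).def'.aestronglyMeasurable
  · refine MeasureTheory.ae_of_all _ fun x hx w hw => hC (w, x) ⟨hw, hsub x hx⟩
  · refine MeasureTheory.ae_of_all _ fun x hx w hw => ?_
    have hx' := hsub x hx
    have h1 : HasDerivAt (fun w : ℂ => 1 - w * ((1 - x : ℝ) : ℂ)) (-((1 - x : ℝ) : ℂ)) w := by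
      simpa using ((hasDerivAt_id w).mul_const ((1 - x : ℝ) : ℂ)).const_sub 1
    have h2 := (h1.cpow_const (c := -a) (one_sub_mul_mem_slitPlane (hball hw)
      ⟨by linarith [hx'.2], by linarith [hx'.1]⟩)).const_mul ((x : ℂ) ^ (c - 2))
    refine h2.congr_deriv ?_
    simp only [K']
    ring

theorem poch_sub_one_mul_betaIntegral {c : ℂ} (hc : 2 < c.re) (n : ℕ) :
    (c - 1) * Complex.betaIntegral (c - 1) (n + 1) = (n ! : ℂ) / poch c n := by
  have h0 : 0 < (c - 1).re := by simp; linarith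
  rw [Complex.betaIntegral_eval_nat_add_one_right h0]
  have e : ∏ j ∈ Finset.range (n + 1), (c - 1 + j) = (c - 1) * poch c n := by
    induction n with
    | zero => simp [poch_zero]
    | succ n ih => rw [Finset.prod_range_succ, ih, poch_succ]; push_cast; ring
  have h1 : c - 1 ≠ 0 := by intro h; rw [h] at h0; simp at h0
  rw [e]
  field_simp

/-- Euler's integral for `₂F₁(a, 1; c; z)`: expand the kernel by the binomial series and integrate
termwise, each term being a beta integral. -/
theorem hasCutContinuation_of_two_lt_re (a : ℂ) {c : ℂ} (hc : 2 < c.re) :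
    HasCutContinuation fun n => poch a n / poch c n := by
  refine ⟨fun z => (c - 1) * ∫ x in (0 : ℝ)..1,
      (x : ℂ) ^ (c - 2) * (1 - z * ((1 - x : ℝ) : ℂ)) ^ (-a),
    (differentiableOn_eulerIntegral a hc).const_mul _, fun z hz => ?_⟩
  have hsub : ∀ x ∈ uIoc (0 : ℝ) 1, x ∈ Icc (0 : ℝ) 1 := fun x hx => by
    rw [uIoc_of_le zero_le_one] at hx
    exact ⟨hx.1.le, hx.2⟩
  have hcx : Continuous fun x : ℝ => (x : ℂ) ^ (c - 2) :=
    Complex.continuous_ofReal_cpow_const (by simpa using hc)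
  obtain ⟨C, hC⟩ := (isCompact_Icc (a := (0 : ℝ)) (b := 1)).exists_bound_of_continuousOn
    hcx.continuousOn
  have hsum : Summable fun n => C * ‖poch a n / (n ! : ℂ) * z ^ n‖ :=
    (hasSum_poch_div_factorial a hz).summable.norm.mul_left C
  have hnorm : ∀ x ∈ Icc (0 : ℝ) 1, ‖((1 - x : ℝ) : ℂ)‖ ≤ 1 := by
    intro x hx
    rw [Complex.norm_real, Real.norm_eq_abs, abs_le]
    constructor <;> linarith [hx.1, hx.2]
  have key := intervalIntegral.hasSum_integral_of_dominated_convergence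
    (μ := MeasureTheory.volume) (a := 0) (b := 1)
    (F := fun (n : ℕ) (x : ℝ) => (x : ℂ) ^ (c - 2) *
      (poch a n / (n ! : ℂ) * (z * ((1 - x : ℝ) : ℂ)) ^ n))
    (f := fun x : ℝ => (x : ℂ) ^ (c - 2) * (1 - z * ((1 - x : ℝ) : ℂ)) ^ (-a))
    (fun n _ => C * ‖poch a n / (n ! : ℂ) * z ^ n‖)
    (fun n => (hcx.mul (by fun_prop)).aestronglyMeasurable)
    (fun n => MeasureTheory.ae_of_all _ fun x hx => by
      rw [norm_mul]
      refine mul_le_mul (hC x (hsub x hx)) ?_ (norm_nonneg _)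
        ((norm_nonneg _).trans (hC x (hsub x hx)))
      rw [mul_pow, ← mul_assoc, norm_mul _ (_ ^ n), norm_pow ((1 - x : ℝ) : ℂ)]
      exact mul_le_of_le_one_right (norm_nonneg _)
        (pow_le_one₀ (norm_nonneg _) (hnorm x (hsub x hx))))
    (MeasureTheory.ae_of_all _ fun x _ => hsum) intervalIntegrable_const
    (MeasureTheory.ae_of_all _ fun x hx => by
      refine (hasSum_poch_div_factorial a ?_).mul_left _
      rw [norm_mul]
      exact lt_of_le_of_lt (mul_le_of_le_one_right (norm_nonneg _) (hnorm x (hsub x hx))) hz)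
  have e : ∀ n : ℕ, poch a n / poch c n * z ^ n = (c - 1) * ∫ x in (0 : ℝ)..1, (x : ℂ) ^ (c - 2) *
      (poch a n / (n ! : ℂ) * (z * ((1 - x : ℝ) : ℂ)) ^ n) := by
    intro n
    have h1 : ∫ x in (0 : ℝ)..1, (x : ℂ) ^ (c - 2) *
        (poch a n / (n ! : ℂ) * (z * ((1 - x : ℝ) : ℂ)) ^ n) =
        (poch a n / (n ! : ℂ) * z ^ n) * Complex.betaIntegral (c - 1) (n + 1) := by
      rw [Complex.betaIntegral, ← intervalIntegral.integral_const_mul]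
      congr 1
      funext x
      rw [mul_pow, show c - 1 - 1 = c - 2 by ring, add_sub_cancel_right, Complex.cpow_natCast]
      push_cast
      ring
    have h2 : (n ! : ℂ) ≠ 0 := by exact_mod_cast Nat.factorial_ne_zero _
    rw [h1, mul_left_comm, poch_sub_one_mul_betaIntegral hc]
    field_simp
  simp only [e]
  exact key.mul_left _

/-- Since `1 / (c)ₙ = (c + n) / (c (c + 1)ₙ)`, continuation for `c + 1` gives it for `c`; finitely
many steps reach `Re c > 2`. -/
theorem hasCutContinuation_poch_div (a : ℂ) {c : ℂ} (hc : ∀ n : ℕ, c ≠ -(n : ℂ)) :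
    HasCutContinuation fun n => poch a n / poch c n := by
  obtain ⟨N, hN⟩ := exists_nat_gt (2 - c.re)
  induction N generalizing c with
  | zero => exact hasCutContinuation_of_two_lt_re a (by simp at hN; linarith)
  | succ N ih =>
    have hc1 : ∀ n : ℕ, c + 1 ≠ -(n : ℂ) := by simpa using ne_neg_nat_add hc 1
    have h := ((ih hc1 (by push_cast at hN; simp; linarith)).add_natCast_mul c).const_mul c⁻¹
    refine (congrArg HasCutContinuation (funext fun n => ?_)).mp h
    have h1 := poch_succ_param_div hc n
    have h2 := poch_ne_zero hc n
    have h3 := poch_ne_zero hc1 n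
    have h4 := ne_zero_of_ne_neg_nat hc
    rw [div_eq_div_iff h2 h4] at h1
    field_simp
    linear_combination -poch a n * h1

theorem HasCutContinuation.mul_prod {u : ℕ → ℂ} (h : HasCutContinuation u) (lam : Multiset ℂ) :
    HasCutContinuation fun n => u n * (lam.map fun l : ℂ => (l + n) / l).prod := by
  induction lam using Multiset.induction_on with
  | empty => simpa using h
  | cons l s ih =>
    refine (congrArg HasCutContinuation (funext fun n => ?_)).mp ((ih.add_natCast_mul l).const_mul l⁻¹)
    rw [Multiset.map_cons, Multiset.prod_cons]
    ring

theorem hasCutContinuation_rhsSeq (a : ℂ) {γ : ℂ} (hγ : ∀ n : ℕ, γ ≠ -(n : ℂ))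
    (lam : Multiset ℂ) : HasCutContinuation fun n => poch a n * (rhsSeq γ lam n / (n ! : ℂ)) := by
  refine (congrArg HasCutContinuation (funext fun n => ?_)).mp
    ((hasCutContinuation_poch_div a hγ).mul_prod lam)
  have h2 : (n ! : ℂ) ≠ 0 := by exact_mod_cast Nat.factorial_ne_zero _
  rw [rhsSeq]
  field_simp

end Continuation

/-! ### Growth bounds and the Euler transformation of series -/

section Euler

open Filter Topology

theorem choose_mul_factorials (k l : ℕ) :
    ((k + l).choose k : ℂ) * (k ! : ℂ) * (l ! : ℂ) = ((k + l)! : ℂ) := by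
  have := Nat.choose_mul_factorial_mul_factorial (Nat.le_add_right k l)
  rw [Nat.add_sub_cancel_left] at this
  exact_mod_cast this

/-- A sequence that grows at most exponentially. -/
def ExpBounded (u : ℕ → ℂ) : Prop :=
  ∃ K ρ : ℝ, 0 ≤ K ∧ 1 ≤ ρ ∧ ∀ n, ‖u n‖ ≤ K * ρ ^ n

theorem ExpBounded.mul {u v : ℕ → ℂ} (hu : ExpBounded u) (hv : ExpBounded v) :
    ExpBounded fun n => u n * v n := by
  obtain ⟨K, ρ, hK, hρ, hu⟩ := hu
  obtain ⟨L, σ, hL, hσ, hv⟩ := hv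
  refine ⟨K * L, ρ * σ, mul_nonneg hK hL, one_le_mul_of_one_le_of_one_le hρ hσ, fun n => ?_⟩
  rw [norm_mul, mul_pow, mul_mul_mul_comm]
  exact mul_le_mul (hu n) (hv n) (norm_nonneg _) (by positivity)

theorem expBounded_one : ExpBounded fun _ => 1 := ⟨1, 1, zero_le_one, le_rfl, by simp⟩

theorem expBounded_prod {ι : Type*} (s : Finset ι) {u : ι → ℕ → ℂ} (h : ∀ i, ExpBounded (u i)) :
    ExpBounded fun n => ∏ i ∈ s, u i n := by
  classical
  induction s using Finset.induction_on with
  | empty => simpa using expBounded_one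
  | insert i s hi ih => simpa [Finset.prod_insert hi] using (h i).mul ih

theorem expBounded_poch_div (β : ℂ) {γ : ℂ} (hγ : ∀ n : ℕ, γ ≠ -(n : ℂ)) :
    ExpBounded fun n => poch β n / poch γ n := by
  -- This is the ratio `(β + n) / (γ + n)` of consecutive terms; being convergent, it is bounded.
  have ht : Tendsto (fun n : ℕ => 1 + (β - γ) / γ * (1 - (n : ℂ) / (n + γ))) atTop
      (𝓝 (1 + (β - γ) / γ * (1 - 1))) :=
    ((tendsto_const_nhds.sub (tendsto_natCast_div_add_atTop γ)).const_mul _).const_add _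
  obtain ⟨C, hC⟩ := (Metric.isBounded_range_of_tendsto _ ht).exists_norm_le
  refine ⟨1, max C 1, zero_le_one, le_max_right _ _, fun n => ?_⟩
  rw [one_mul]
  induction n with
  | zero => simp [poch_zero]
  | succ n ih =>
    have h1 : γ + n ≠ 0 := fun h => hγ n (by linear_combination h)
    have h2 := ne_zero_of_ne_neg_nat hγ
    have e : (β + n) / (γ + n) = 1 + (β - γ) / γ * (1 - (n : ℂ) / (n + γ)) := by
      have : (n : ℂ) + γ ≠ 0 := by rwa [add_comm]
      field_simp
      ring
    simp only [poch_succ]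
    rw [mul_div_mul_comm, norm_mul, pow_succ, e]
    exact mul_le_mul ih ((hC _ ⟨n, rfl⟩).trans (le_max_left _ _)) (norm_nonneg _) (by positivity)

theorem expBounded_lhsSeq {r : ℕ} (f : Fin r → ℂ) (m : Fin r → ℕ)
    (hf : ∀ j, ∀ n : ℕ, f j ≠ -(n : ℂ)) {b : ℂ}
    (hb : ∀ n : ℕ, b + (∑ j, m j : ℕ) ≠ -(n : ℂ)) : ExpBounded (lhsSeq f m b) := by
  refine (congrArg ExpBounded (funext fun n => ?_)).mp ((expBounded_poch_div b hb).mul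
    (expBounded_prod Finset.univ fun j => expBounded_poch_div (f j + m j) (hf j)))
  rw [lhsSeq, numerPoly_eval, vecPoch, ← Finset.prod_div_distrib]
  congr 1
  exact Finset.prod_congr rfl fun j _ => poch_shift_div (hf j) _ _

theorem expBounded_rhsSeq {γ : ℂ} (hγ : ∀ n : ℕ, γ ≠ -(n : ℂ)) {lam : Multiset ℂ}
    (hlam : ∀ l ∈ lam, ∀ n : ℕ, l ≠ -(n : ℂ)) : ExpBounded (rhsSeq γ lam) := by
  have h : ExpBounded fun n => (lam.map fun l : ℂ => (l + n) / l).prod := by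
    induction lam using Multiset.induction_on with
    | empty => simpa using expBounded_one
    | cons l s ih =>
      refine (congrArg ExpBounded (funext fun n => ?_)).mp
        ((expBounded_poch_div (l + 1) (hlam l (Multiset.mem_cons_self l s))).mul
          (ih fun k hk => hlam k (Multiset.mem_cons_of_mem hk)))
      rw [poch_succ_param_div (hlam l (Multiset.mem_cons_self l s)), Multiset.map_cons,
        Multiset.prod_cons]
  refine (congrArg ExpBounded (funext fun n => ?_)).mp ((expBounded_poch_div 1 hγ).mul h)
  rw [rhsSeq, poch_one]

theorem ExpBounded.summable_norm_div_factorial {u : ℕ → ℂ} (hu : ExpBounded u) (z : ℂ) :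
    Summable fun n => ‖u n / (n ! : ℂ) * z ^ n‖ := by
  obtain ⟨K, ρ, hK, hρ, hu⟩ := hu
  refine Summable.of_nonneg_of_le (fun _ => norm_nonneg _) (fun n => ?_)
    ((Real.summable_pow_div_factorial (ρ * ‖z‖)).mul_left K)
  rw [norm_mul, norm_div, norm_pow, Complex.norm_natCast, mul_pow]
  calc _ ≤ K * ρ ^ n / (n ! : ℝ) * ‖z‖ ^ n := by gcongr; exact hu n
    _ = _ := by ring

/-- The confluent form of the Euler transformation. -/
theorem ExpBounded.hasSum_binomTransform_div_factorial {c : ℕ → ℂ} (hc : ExpBounded c) (x : ℂ) :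
    HasSum (fun n => binomTransform c n / (n ! : ℂ) * (-x) ^ n)
      (Complex.exp (-x) * ∑' n, c n / (n ! : ℂ) * x ^ n) := by
  have h1 := hc.summable_norm_div_factorial x
  have h2 : Summable fun n : ℕ => ‖(-x) ^ n / (n ! : ℂ)‖ := by
    simpa [div_eq_inv_mul] using expBounded_one.summable_norm_div_factorial (-x)
  have h3 : Complex.exp (-x) = ∑' n : ℕ, (-x) ^ n / (n ! : ℂ) := by
    rw [Complex.exp_eq_exp_ℂ, NormedSpace.exp_eq_tsum_div]
  -- The Cauchy product with the exponential series produces the binomial transform.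
  have e : ∀ n : ℕ, ∑ k ∈ Finset.range (n + 1), (c k / (k ! : ℂ) * x ^ k) *
      ((-x) ^ (n - k) / ((n - k)! : ℂ)) = binomTransform c n / (n ! : ℂ) * (-x) ^ n := by
    intro n
    rw [binomTransform, Finset.sum_div, Finset.sum_mul]
    refine Finset.sum_congr rfl fun k hk => ?_
    obtain ⟨l, rfl⟩ := Nat.exists_eq_add_of_le (Nat.lt_succ_iff.1 (Finset.mem_range.1 hk))
    have h4 : ((k + l).choose k : ℂ) * (k ! : ℂ) * (l ! : ℂ) = ((k + l)! : ℂ) := choose_mul_factorials k l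
    have h5 : ∀ j : ℕ, (j ! : ℂ) ≠ 0 := fun j => by exact_mod_cast Nat.factorial_ne_zero _
    rw [Nat.add_sub_cancel_left, ← h4, pow_add, neg_pow x k]
    have h6 : ((k + l).choose k : ℂ) ≠ 0 := fun h => h5 (k + l) (by rw [← h4, h]; ring)
    have h7 : ((-1 : ℂ) ^ k) ^ 2 = 1 := by rw [← pow_mul, mul_comm, pow_mul]; simp
    have := h5 k
    have := h5 l
    calc _ = ((-1 : ℂ) ^ k) ^ 2 * (c k / (k ! : ℂ) * x ^ k * ((-x) ^ l / (l ! : ℂ))) := by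
          rw [h7, one_mul]
      _ = _ := by field_simp
  have hs := (summable_norm_sum_mul_range_of_summable_norm h1 h2).of_norm
  have ht := tsum_mul_tsum_eq_tsum_sum_range_of_summable_norm h1 h2
  simp only [e] at hs ht
  rw [h3, mul_comm, ht]
  exact hs.hasSum

/-- The terms of the double series behind the Euler transformation. -/
def eulerTerm (a : ℂ) (c : ℕ → ℂ) (y : ℂ) (p : ℕ × ℕ) : ℂ :=
  poch a (p.1 + p.2) / ((p.1 ! : ℂ) * (p.2 ! : ℂ)) * c p.1 * (-y) ^ p.1 * y ^ p.2

theorem ExpBounded.eventually_summable_eulerTerm {c : ℕ → ℂ} (hc : ExpBounded c) (a : ℂ) :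
    ∀ᶠ y in 𝓝 (0 : ℂ), Summable (eulerTerm a c y) := by
  obtain ⟨K, ρ, hK, hρ, hc⟩ := hc
  obtain ⟨L, σ, hL, hσ, ha⟩ := expBounded_poch_div a (γ := 1) (fun n h => by
    have : ((1 + n : ℕ) : ℂ) = 0 := by push_cast; rw [h]; ring
    rw [Nat.cast_eq_zero] at this
    omega)
  -- The terms are dominated by a product of geometric series of ratios `2σρ‖y‖` and `2σ‖y‖`; the
  -- `2` bounds the binomial coefficients.
  have hpos : (0 : ℝ) < 1 / (2 * σ * ρ) := by positivity
  filter_upwards [Metric.ball_mem_nhds (0 : ℂ) hpos] with y hy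
  have hy : 2 * σ * ρ * ‖y‖ < 1 := by
    have : ‖y‖ < 1 / (2 * σ * ρ) := by simpa using hy
    rw [lt_div_iff₀ (by positivity)] at this
    linarith
  have hy' : 2 * σ * ‖y‖ < 1 := by
    refine lt_of_le_of_lt ?_ hy
    have : 0 ≤ 2 * σ * ‖y‖ := by positivity
    nlinarith
  have hs := ((summable_geometric_of_lt_one (by positivity) hy).mul_of_nonneg
    (summable_geometric_of_lt_one (by positivity) hy') (fun n => by positivity)
    (fun n => by positivity)).mul_left (L * K)
  refine Summable.of_norm_bounded hs ?_
  rintro ⟨n, k⟩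
  have h1 : ‖poch a (n + k) / ((n ! : ℂ) * (k ! : ℂ))‖ ≤ L * σ ^ (n + k) * 2 ^ (n + k) := by
    have h4 : ((n + k).choose n : ℂ) * (n ! : ℂ) * (k ! : ℂ) = ((n + k)! : ℂ) := choose_mul_factorials n k
    have h5 : ∀ j : ℕ, (j ! : ℂ) ≠ 0 := fun j => by exact_mod_cast Nat.factorial_ne_zero _
    have h6 : ((n + k).choose n : ℂ) ≠ 0 := fun h => h5 (n + k) (by rw [← h4, h]; ring)
    have e : poch a (n + k) / ((n ! : ℂ) * (k ! : ℂ)) =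
        poch a (n + k) / poch 1 (n + k) * ((n + k).choose n : ℂ) := by
      have := h5 n
      have := h5 k
      rw [poch_one, ← h4]
      field_simp
    rw [e, norm_mul, Complex.norm_natCast]
    exact mul_le_mul (ha _) (by exact_mod_cast Nat.choose_le_two_pow _ _) (by positivity)
      (by positivity)
  simp only [eulerTerm, norm_mul, norm_pow, norm_neg]
  calc _ ≤ L * σ ^ (n + k) * 2 ^ (n + k) * (K * ρ ^ n) * ‖y‖ ^ n * ‖y‖ ^ k := by
        gcongr
        exact hc n
    _ = _ := by ring

/-- `(a)_{n+k} = (a)ₙ (a + n)ₖ`, and the sum over `k` is the binomial series for `(1 - y)^(-a-n)`.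
-/
theorem hasSum_eulerTerm_right (a : ℂ) (c : ℕ → ℂ) {y : ℂ} (hy : ‖y‖ < 1) (n : ℕ) :
    HasSum (fun k => eulerTerm a c y (n, k))
      ((1 - y) ^ (-a) * (poch a n * (c n / (n ! : ℂ)) * (y / (y - 1)) ^ n)) := by
  have h1 : 1 - y ≠ 0 := by
    intro h
    rw [← sub_eq_zero.1 h] at hy
    simp at hy
  have h2 : y - 1 ≠ 0 := by intro h; exact h1 (by linear_combination -h)
  have h := (hasSum_poch_div_factorial (a + n) hy).mul_left
    (poch a n / (n ! : ℂ) * c n * (-y) ^ n)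
  have e : poch a n / (n ! : ℂ) * c n * (-y) ^ n * (1 - y) ^ (-(a + n)) =
      (1 - y) ^ (-a) * (poch a n * (c n / (n ! : ℂ)) * (y / (y - 1)) ^ n) := by
    rw [neg_add, Complex.cpow_add _ _ h1, Complex.cpow_neg _ (n : ℂ), Complex.cpow_natCast,
      show y / (y - 1) = -y / (1 - y) by rw [div_eq_div_iff h2 h1]; ring, div_pow]
    ring
  rw [e] at h
  refine (congrArg (fun g : ℕ → ℂ => HasSum g _) (funext fun k => ?_)).mp h
  simp only [eulerTerm]
  rw [poch_add]
  ring

theorem sum_antidiagonal_eulerTerm (a : ℂ) (c : ℕ → ℂ) (y : ℂ) (N : ℕ) :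
    ∑ p ∈ Finset.HasAntidiagonal.antidiagonal N, eulerTerm a c y p =
      poch a N * (binomTransform c N / (N ! : ℂ)) * y ^ N := by
  rw [Finset.Nat.sum_antidiagonal_eq_sum_range_succ_mk, binomTransform, Finset.sum_div,
    Finset.mul_sum, Finset.sum_mul]
  refine Finset.sum_congr rfl fun k hk => ?_
  obtain ⟨l, rfl⟩ := Nat.exists_eq_add_of_le (Nat.lt_succ_iff.1 (Finset.mem_range.1 hk))
  have h4 : ((k + l).choose k : ℂ) * (k ! : ℂ) * (l ! : ℂ) = ((k + l)! : ℂ) := choose_mul_factorials k l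
  have h5 : ∀ j : ℕ, (j ! : ℂ) ≠ 0 := fun j => by exact_mod_cast Nat.factorial_ne_zero _
  have h6 : ((k + l).choose k : ℂ) ≠ 0 := fun h => h5 (k + l) (by rw [← h4, h]; ring)
  have := h5 k
  have := h5 l
  simp only [eulerTerm]
  rw [Nat.add_sub_cancel_left, ← h4, pow_add, neg_pow y k]
  field_simp

/-- The Euler transformation of a power series near the origin. -/
theorem ExpBounded.eventually_hasSum_euler {c : ℕ → ℂ} (hc : ExpBounded c) (a : ℂ) :
    ∀ᶠ y in 𝓝 (0 : ℂ), ∃ S : ℂ,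
      HasSum (fun n => poch a n * (c n / (n ! : ℂ)) * (y / (y - 1)) ^ n) ((1 - y) ^ a * S) ∧
      HasSum (fun n => poch a n * (binomTransform c n / (n ! : ℂ)) * y ^ n) S := by
  filter_upwards [hc.eventually_summable_eulerTerm a, Metric.ball_mem_nhds (0 : ℂ) one_pos]
    with y hs hy
  have hy : ‖y‖ < 1 := by simpa using hy
  have h1 : 1 - y ≠ 0 := by
    intro h
    rw [← sub_eq_zero.1 h] at hy
    simp at hy
  -- The same double sum is taken by rows, then by antidiagonals.
  obtain ⟨S, hS⟩ := hs
  refine ⟨S, ?_, ?_⟩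
  · have := (hS.prod_fiberwise (hasSum_eulerTerm_right a c hy)).mul_left ((1 - y) ^ a)
    refine (congrArg (fun g : ℕ → ℂ => HasSum g _) (funext fun n => ?_)).mp this
    rw [← mul_assoc, ← Complex.cpow_add _ _ h1]
    simp
  · have := ((Finset.HasAntidiagonal.sigmaAntidiagonalEquivProd (A := ℕ)).hasSum_iff.2 hS).sigma
      (fun N => hasSum_fintype _)
    refine (congrArg (fun g : ℕ → ℂ => HasSum g _) (funext fun N => ?_)).mp this
    rw [← sum_antidiagonal_eulerTerm]
    exact Finset.sum_coe_sort (Finset.HasAntidiagonal.antidiagonal N) (eulerTerm a c y)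

end Euler

/-! ### The transformation on the cut plane and the theorem -/

section Transformation

open Filter Topology

/-- The map is an involution sending real `t > 1` to `t / (t - 1) > 1`, and it never takes the value
`1`. -/
theorem div_sub_one_mem_cutPlane {x : ℂ} (hx : x ∈ cutPlane) : x / (x - 1) ∈ cutPlane := by
  rintro ⟨h1, h2⟩
  have hx1 : x - 1 ≠ 0 := fun h => hx (by rw [sub_eq_zero.1 h]; simp)
  obtain ⟨t, ht⟩ : ∃ t : ℝ, x / (x - 1) = t := ⟨_, Complex.ext rfl h1⟩
  rw [ht, Complex.ofReal_re] at h2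
  have h3 : x * (t - 1) = t := by
    rw [div_eq_iff hx1] at ht
    linear_combination -ht
  have h4 : t - 1 ≠ 0 := by
    intro h
    have h5 : (t : ℂ) = 1 := by exact_mod_cast sub_eq_zero.1 h
    rw [h5] at h3
    simp at h3
  have h5 : x = ((t / (t - 1) : ℝ) : ℂ) := by
    have : (t : ℂ) - 1 ≠ 0 := by exact_mod_cast h4
    push_cast
    rw [eq_div_iff this, h3]
  have h6 : 0 < t - 1 := lt_of_le_of_ne (by linarith) h4.symm
  refine hx ?_
  rw [h5, Complex.ofReal_im, Complex.ofReal_re, one_le_div h6]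
  exact ⟨rfl, by linarith⟩

theorem one_sub_mem_slitPlane {x : ℂ} (hx : x ∈ cutPlane) : 1 - x ∈ Complex.slitPlane := by
  simpa using one_sub_mul_mem_slitPlane hx (t := 1) (by simp)

theorem isPFq_pFq {s t : Multiset ℂ} {F : ℂ → ℂ} (h : IsPFq s t F) : IsPFq s t (pFq s t) :=
  Classical.epsilon_spec (p := IsPFq s t) ⟨F, h⟩

theorem hasSum_ite_zero_add_mul {A S z : ℂ} {u v : ℕ → ℂ} (h : HasSum (fun n => v n * z ^ n) S)
    (huv : ∀ n, u n = (if n = 0 then A else 0) + (1 - A) * v n) :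
    HasSum (fun n => u n * z ^ n) (A + (1 - A) * S) := by
  have h1 := (hasSum_ite_eq (0 : ℕ) A).add (h.mul_left (1 - A))
  refine (congrArg (fun g : ℕ → ℂ => HasSum g _) (funext fun n => ?_)).mp h1
  rw [huv]
  rcases n with _ | n
  · simp
  · simp
    ring

/-- If `G` continues the series with coefficients `(a)ₙ vₙ / n!` to the cut plane, then the
right-hand side of the Euler transformation continues the series with coefficients
`(a)ₙ cₙ / n!`. -/
theorem ExpBounded.euler_continuation {c v : ℕ → ℂ} {A a : ℂ} (hc : ExpBounded c)
    (hcv : ∀ n, binomTransform c n = (if n = 0 then A else 0) + (1 - A) * v n) {G : ℂ → ℂ}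
    (hG : DifferentiableOn ℂ G cutPlane)
    (hGs : ∀ z : ℂ, ‖z‖ < 1 → HasSum (fun n => poch a n * (v n / (n ! : ℂ)) * z ^ n) (G z)) :
    DifferentiableOn ℂ (fun x => (1 - x) ^ (-a) * (A + (1 - A) * G (x / (x - 1)))) cutPlane ∧
    ∀ x : ℂ, ‖x‖ < 1 → HasSum (fun n => poch a n * (c n / (n ! : ℂ)) * x ^ n)
      ((1 - x) ^ (-a) * (A + (1 - A) * G (x / (x - 1)))) := by
  have hx1 : ∀ x ∈ cutPlane, x - 1 ≠ 0 := fun x hx h => hx (by rw [sub_eq_zero.1 h]; simp)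
  have hdiv : DifferentiableOn ℂ (fun x : ℂ => x / (x - 1)) cutPlane :=
    differentiableOn_id.div (by fun_prop) hx1
  have hd : DifferentiableOn ℂ (fun x => (1 - x) ^ (-a) * (A + (1 - A) * G (x / (x - 1))))
      cutPlane := by
    refine DifferentiableOn.mul (DifferentiableOn.cpow_const (by fun_prop) fun x hx =>
      one_sub_mem_slitPlane hx) (((hG.comp hdiv fun x hx =>
        div_sub_one_mem_cutPlane hx).const_mul _).const_add _)
  refine ⟨hd, fun x hx => hasSum_of_eventually_of_differentiableOn hd ?_ hx⟩
  have ht : Tendsto (fun x : ℂ => x / (x - 1)) (𝓝 0) (𝓝 0) := by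
    have := (hdiv.continuousOn.continuousAt (isOpen_cutPlane.mem_nhds zero_mem_cutPlane)).tendsto
    simpa using this
  filter_upwards [ht.eventually (hc.eventually_hasSum_euler a),
    ht.eventually (Metric.ball_mem_nhds (0 : ℂ) one_pos),
    isOpen_cutPlane.mem_nhds zero_mem_cutPlane] with x hx hy hxc
  obtain ⟨S, hS1, hS2⟩ := hx
  have h1 := hx1 x hxc
  have h1' : 1 - x ≠ 0 := by intro h; exact h1 (by linear_combination -h)
  have hS : S = A + (1 - A) * G (x / (x - 1)) := by
    refine hS2.unique (hasSum_ite_zero_add_mul (hGs _ (by simpa using hy)) fun n => ?_)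
    rw [hcv]
    rcases n with _ | n
    · simp [poch_zero]
    · simp
      ring
  have e1 : x / (x - 1) / (x / (x - 1) - 1) = x := by
    have : x / (x - 1) - 1 = 1 / (x - 1) := by field_simp; ring
    rw [this]
    field_simp
  have e2 : 1 - x / (x - 1) = (1 - x)⁻¹ := by
    rw [← neg_sub x 1] at h1' ⊢
    field_simp
    ring
  -- The principal branches agree because `1 - x` lies off the negative axis.
  have e3 : (1 - x / (x - 1)) ^ a = (1 - x) ^ (-a) := by
    rw [e2, Complex.inv_cpow _ _ (Complex.slitPlane_arg_ne_pi (one_sub_mem_slitPlane hxc)),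
      Complex.cpow_neg]
  rw [e1, e3, hS] at hS1
  exact hS1

end Transformation

end HypergeomCorollary

end

open HypergeomCorollary in
theorem corollary1 (r : ℕ) (hr : 0 < r) (m : Fin r → ℕ) (hm : ∀ j, 0 < m j)
    (M : ℕ) (hM : M = ∑ j, m j) (a b : ℂ) (f : Fin r → ℂ)
    (hf : ∀ j, ∀ n : ℕ, f j ≠ -(n : ℂ))
    (hb : ∀ n : ℕ, b + (M : ℂ) ≠ -(n : ℂ))
    (hfb : r = 1 → M = 1 → ∀ j, f j ≠ b)
    (lam : Multiset ℂ) (hlam : lam = (HypergeomCorollary.redPoly b f m).roots)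
    (hlam0 : ∀ l ∈ lam, ∀ n : ℕ, l ≠ -(n : ℂ))
    (A : ℂ) (hA : A = HypergeomCorollary.poch b M / HypergeomCorollary.vecPoch f m) :
    -- the four hypergeometric functions exist
    (∃ F, HypergeomCorollary.IsPFq
      (a ::ₘ b ::ₘ HypergeomCorollary.shiftedParams f m)
      ((b + (M : ℂ)) ::ₘ HypergeomCorollary.params f) F) ∧
    (∃ F, HypergeomCorollary.IsPFq
      (1 ::ₘ a ::ₘ lam.map (fun l => l + 1)) ((b + (M : ℂ)) ::ₘ lam) F) ∧
    (∃ F, HypergeomCorollary.IsPFq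
      (b ::ₘ HypergeomCorollary.shiftedParams f m)
      ((b + (M : ℂ)) ::ₘ HypergeomCorollary.params f) F) ∧
    (∃ F, HypergeomCorollary.IsPFq
      (1 ::ₘ lam.map (fun l => l + 1)) ((b + (M : ℂ)) ::ₘ lam) F) ∧
    -- the transformation on the cut plane
    (∀ x ∈ HypergeomCorollary.cutPlane,
      (1 - x) ^ a * HypergeomCorollary.pFq
          (a ::ₘ b ::ₘ HypergeomCorollary.shiftedParams f m)
          ((b + (M : ℂ)) ::ₘ HypergeomCorollary.params f) x =
        A + (1 - A) * HypergeomCorollary.pFq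
          (1 ::ₘ a ::ₘ lam.map (fun l => l + 1)) ((b + (M : ℂ)) ::ₘ lam) (x / (x - 1))) ∧
    -- the confluent transformation on the whole plane
    (∀ x : ℂ,
      Complex.exp (-x) * HypergeomCorollary.pFq
          (b ::ₘ HypergeomCorollary.shiftedParams f m)
          ((b + (M : ℂ)) ::ₘ HypergeomCorollary.params f) x =
        A + (1 - A) * HypergeomCorollary.pFq
          (1 ::ₘ lam.map (fun l => l + 1)) ((b + (M : ℂ)) ::ₘ lam) (-x)) := by
  subst hM hlam
  have hM : 0 < ∑ j, m j :=
    (hm ⟨0, hr⟩).trans_le (Finset.single_le_sum (f := m) (fun _ _ => Nat.zero_le _)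
      (Finset.mem_univ _))
  have hc := expBounded_lhsSeq f m hf hb
  have hR0 : ∀ l ∈ (redPoly b f m).roots, l ≠ 0 := fun l hl => by simpa using hlam0 l hl 0
  have hcv := binomTransform_lhsSeq_eq_rhsSeq f m hM hf hb hR0
  rw [← hA] at hcv
  have hcard : (params f).card = r := by simp [params]
  have hcard' : (shiftedParams f m).card = r := by simp [shiftedParams]
  obtain ⟨G, hG, hGs⟩ := hasCutContinuation_rhsSeq a hb (redPoly b f m).roots
  obtain ⟨hF, hFs⟩ := hc.euler_continuation hcv hG hGs
  have hv : ExpBounded (rhsSeq (b + (∑ j, m j : ℕ)) (redPoly b f m).roots) :=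
    expBounded_rhsSeq hb hlam0
  set lam := (redPoly b f m).roots
  -- The witness is the desired right-hand side times `(1 - x)^(-a)`; by uniqueness of continuation,
  -- the first identity follows.
  have i1 : IsPFq (a ::ₘ b ::ₘ shiftedParams f m) ((b + (∑ j, m j : ℕ)) ::ₘ params f)
      (fun x => (1 - x) ^ (-a) * (A + (1 - A) * G (x / (x - 1)))) := by
    refine ⟨fun z hz => ?_, fun _ => hF⟩
    simp only [pFqCoeff_cons a, pFqCoeff_shifted f m hf]
    exact hFs z (hz.resolve_left (by simp [hcard, hcard']))
  have i2 : IsPFq (1 ::ₘ a ::ₘ lam.map (fun l => l + 1)) ((b + (∑ j, m j : ℕ)) ::ₘ lam) G := by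
    refine ⟨fun z hz => ?_, fun _ => hG⟩
    rw [Multiset.cons_swap]
    simp only [pFqCoeff_cons a, pFqCoeff_one_cons hlam0]
    exact hGs z (hz.resolve_left (by simp))
  have i3 : IsPFq (b ::ₘ shiftedParams f m) ((b + (∑ j, m j : ℕ)) ::ₘ params f)
      (fun x => ∑' n, lhsSeq f m b n / (n.factorial : ℂ) * x ^ n) := by
    refine ⟨fun z _ => ?_, fun h => absurd h (by simp [hcard, hcard'])⟩
    simp only [pFqCoeff_shifted f m hf]
    exact (hc.summable_norm_div_factorial z).of_norm.hasSum
  have i4 : IsPFq (1 ::ₘ lam.map (fun l => l + 1)) ((b + (∑ j, m j : ℕ)) ::ₘ lam)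
      (fun x => ∑' n, rhsSeq (b + (∑ j, m j : ℕ)) lam n / (n.factorial : ℂ) * x ^ n) := by
    refine ⟨fun z _ => ?_, fun h => absurd h (by simp)⟩
    simp only [pFqCoeff_one_cons hlam0]
    exact (hv.summable_norm_div_factorial z).of_norm.hasSum
  refine ⟨⟨_, i1⟩, ⟨_, i2⟩, ⟨_, i3⟩, ⟨_, i4⟩, fun x hx => ?_, fun x => ?_⟩
  · rw [(isPFq_pFq i1).eqOn_cutPlane i1 (by simp [hcard, hcard']) hx,
      (isPFq_pFq i2).eqOn_cutPlane i2 (by simp) (div_sub_one_mem_cutPlane hx), ← mul_assoc,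
      ← Complex.cpow_add _ _ (Complex.slitPlane_ne_zero (one_sub_mem_slitPlane hx))]
    simp
  · rw [(isPFq_pFq i3).eq_of_card_le i3 (by simp [hcard, hcard']),
      (isPFq_pFq i4).eq_of_card_le i4 (by simp)]
    refine (hc.hasSum_binomTransform_div_factorial x).unique ?_
    refine hasSum_ite_zero_add_mul (hv.summable_norm_div_factorial (-x)).of_norm.hasSum fun n => ?_
    rw [hcv]
    rcases n with _ | n
    · simp
    · simp
      ring
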